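/- Let $\mathbb{F}_q$ be the finite field of order $q$. The dot-product graph on $\mathbb{F}_q^3$ has vertex set $\mathbb{F}_q^3\setminus\{0\}$, and two (not necessarily distinct) vertices $x,y$ are adjacent, written $x\sim y$, if $x_1y_1+x_2y_2+x_3y_3=1$ (so loops are allowed). For a set $U$ of vertices and $v\in U$, let $h_v\colon U\to\{0,1\}$ be the function with $h_v(u)=1$ if $u\sim v$ and $h_v(u)=0$ otherwise, and let $\mathcal{H}(U)=\{h_v : v\in U\}$. A set $X\subseteq U$ is shattered by $\mathcal{H}(U)$ if every function $X\to\{0,1\}$ is the restriction to $X$ of a member of $\mathcal{H}(U)$; the VC-dimension of $\mathcal{H}(U)$ is the largest size of a set $X\subseteq U$ that is shattered by $\mathcal{H}(U)$. Theorem. There is an absolute constant $C>0$ such that, for every prime power $q$ and every set $U\subseteq\mathbb{F}_q^3\setminus\{0\}$ of vertices of the dot-product graph, the following hold. 1. If $|U|\ge Cq^{2}$, then the VC-dimension of $\mathcal{H}(U)$ is at least $2$. 2. If $|U|\ge Cq^{5/2}$, then the VC-dimension of $\mathcal{H}(U)$ is equal to $3$. -/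

import Mathlib

namespace DotProductVC

/-- The vertex set of the dot-product graph on `F ^ t`: all non-zero vectors. -/
abbrev Vertex (F : Type*) [Field F] (t : ℕ) : Type _ := {x : Fin t → F // x ≠ 0}

/-- Adjacency in the dot-product graph: `x ∼ y` if and only if `x₁ y₁ + ⋯ + x_t y_t = 1`.
This is a graph with loops: `x ∼ x` whenever `x ⬝ᵥ x = 1`. -/
def Adj {F : Type*} [Field F] {t : ℕ} (x y : Vertex F t) : Prop :=
  dotProduct x.1 y.1 = 1

open Classical in
/-- For a set `U` of vertices of a graph with adjacency relation `adj`, and a vertex `v`, the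
function `h_v : U → {0, 1}` with `h_v u = 1` if `u ∼ v` and `h_v u = 0` otherwise. -/
noncomputable def adjFun {V : Type*} (adj : V → V → Prop) (U : Finset V) (v : V) : U → Bool :=
  fun u => decide (adj u v)

open Classical in
/-- The family `H(U) = {h_v : v ∈ U}` of functions `U → {0, 1}`. -/
noncomputable def adjFamily {V : Type*} (adj : V → V → Prop) (U : Finset V) :
    Finset (U → Bool) :=
  U.image (adjFun adj U)

open Classical in
/-- The Vapnik–Chervonenkis dimension of a family of `{0, 1}`-valued functions on a finite set:
the largest size of a set that it shatters. It is expressed by Mathlib's `Finset.vcDim` for set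
families, each function being identified with the set where it takes the value `1`. -/
noncomputable def vcDim {X : Type*} [Fintype X] (H : Finset (X → Bool)) : ℕ :=
  (H.image fun h => Finset.univ.filter fun x => h x = true).vcDim

end DotProductVC

namespace DotProductVC

/-! Already `200 q ^ 2` vertices force dimension exactly 3, which gives both claims. At most 3: four
vectors of `F ^ 3` are linearly dependent, and a dependence fixes the product with one of them once
the others are prescribed (`not_shattered_four`). At least 3: by a second moment bound
(`card_low_degree_mul_le`), most `y ∈ W` have many neighbours of high degree. A pair is bad for `y`
if `y` is its only common neighbour in `W`. A pair is bad for at most one `y`, so some `y` has few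
bad pairs, and its neighbourhood contains independent `a, b, c` with no bad pair
(`exists_good_triple`). Then `y` sees all three. A second common neighbour of two of them misses the
third, as `y` is the only vector adjacent to all. Degree counts give the smaller subsets. -/

section DotProduct

open Finset


/-! ### Common neighbours of one or two vectors -/

section Counting

variable {F : Type*} [Field F]

/-- If `u ≠ u'` have a common neighbour in the dot-product graph, then `u ⨯₃ u' ≠ 0`. -/
theorem crossProduct_ne_zero {u u' y : Fin 3 → F} (huu : u ≠ u') (h : u ⬝ᵥ y = 1)
    (h' : u' ⬝ᵥ y = 1) : crossProduct u u' ≠ 0 := by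
  intro hc
  apply huu
  rw [cross_apply] at hc
  have h0 := congrFun hc 0
  have h1 := congrFun hc 1
  have h2 := congrFun hc 2
  simp only [Matrix.cons_val_zero, Matrix.cons_val_one, Matrix.cons_val, Pi.zero_apply] at h0 h1 h2
  simp only [dotProduct, Fin.sum_univ_three] at h h'
  ext i
  -- Coordinates of `y ⨯₃ (u ⨯₃ u') = (y ⬝ᵥ u') • u - (y ⬝ᵥ u) • u' = u - u'`.
  fin_cases i
  · simp only [Fin.zero_eta]
    linear_combination (-u 0) * h' + u' 0 * h + y 1 * h2 - y 2 * h1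
  · simp only [Fin.mk_one]
    linear_combination (-u 1) * h' + u' 1 * h - y 0 * h2 + y 2 * h0
  · simp only [Fin.reduceFinMk]
    linear_combination (-u 2) * h' + u' 2 * h + y 0 * h1 - y 1 * h0

/-- The coordinate `y i` determines a common neighbour `y` of `u` and `u'` whenever
`(u ⨯₃ u') i ≠ 0`. -/
theorem eq_of_crossProduct_apply_ne_zero {u u' y z : Fin 3 → F} {i : Fin 3}
    (hi : crossProduct u u' i ≠ 0) (hy : u ⬝ᵥ y = 1) (hy' : u' ⬝ᵥ y = 1) (hz : u ⬝ᵥ z = 1)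
    (hz' : u' ⬝ᵥ z = 1) (hyz : y i = z i) : y = z := by
  rw [cross_apply] at hi
  simp only [dotProduct, Fin.sum_univ_three] at hy hy' hz hz'
  ext j
  refine mul_left_cancel₀ hi ?_
  -- `z - y` is orthogonal to `u` and `u'`, hence proportional to `u ⨯₃ u'`.
  fin_cases i <;> fin_cases j <;>
    simp only [Fin.zero_eta, Fin.mk_one, Fin.reduceFinMk, Matrix.cons_val_zero,
      Matrix.cons_val_one, Matrix.cons_val] at hyz ⊢ <;>
    try rw [hyz]
  · linear_combination u 2 * (hz' - hy') - u' 2 * (hz - hy) + (u 2 * u' 0 - u 0 * u' 2) * hyz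
  · linear_combination -u 1 * (hz' - hy') + u' 1 * (hz - hy) + (u 0 * u' 1 - u 1 * u' 0) * hyz
  · linear_combination -u 2 * (hz' - hy') + u' 2 * (hz - hy) + (u 1 * u' 2 - u 2 * u' 1) * hyz
  · linear_combination u 0 * (hz' - hy') - u' 0 * (hz - hy) + (u 0 * u' 1 - u 1 * u' 0) * hyz
  · linear_combination u 1 * (hz' - hy') - u' 1 * (hz - hy) + (u 1 * u' 2 - u 2 * u' 1) * hyz
  · linear_combination -u 0 * (hz' - hy') + u' 0 * (hz - hy) + (u 2 * u' 0 - u 0 * u' 2) * hyz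

variable [Fintype F] [DecidableEq F]

/-- Two distinct vectors have at most `q` common neighbours. -/
theorem card_common_le {u u' : Fin 3 → F} (huu : u ≠ u') (A : Finset (Fin 3 → F)) :
    #{y ∈ A | u ⬝ᵥ y = 1 ∧ u' ⬝ᵥ y = 1} ≤ Fintype.card F := by
  rcases Finset.eq_empty_or_nonempty {y ∈ A | u ⬝ᵥ y = 1 ∧ u' ⬝ᵥ y = 1} with he | ⟨y, hy⟩
  · simp [he]
  obtain ⟨-, h, h'⟩ := by simpa using hy
  obtain ⟨i, hi⟩ := Function.ne_iff.1 (crossProduct_ne_zero huu h h')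
  refine Finset.card_le_card_of_injOn (fun y => y i) (by simp) ?_
  intro y hy z hz hyz
  simp only [coe_filter, Set.mem_ofPred_eq] at hy hz
  exact eq_of_crossProduct_apply_ne_zero hi hy.2.1 hy.2.2 hz.2.1 hz.2.2 hyz

/-- A non-zero vector has exactly `q ^ 2` neighbours. -/
theorem card_neighbours {u : Fin 3 → F} (hu : u ≠ 0) :
    #{y : Fin 3 → F | u ⬝ᵥ y = 1} = Fintype.card F ^ 2 := by
  obtain ⟨i, hi⟩ := Function.ne_iff.1 hu
  let f : (Fin 3 → F) →+ F := AddMonoidHom.mk' (fun y => u ⬝ᵥ y) (fun a b => dotProduct_add u a b)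
  have hf : Function.Surjective f := fun c => ⟨Pi.single i ((u i)⁻¹ * c), by
    simp only [Pi.zero_apply] at hi
    simp [f, hi]⟩
  have key : ∀ c : F, #{y : Fin 3 → F | f y = c} = #{y : Fin 3 → F | f y = 1} := fun c =>
    AddMonoidHom.card_fiber_eq_of_mem_range f (hf c) (hf 1)
  have h := Finset.card_eq_sum_card_fiberwise (f := f) (s := univ) (t := univ) (by simp)
  rw [Finset.sum_congr rfl fun c _ => key c] at h
  simp only [card_univ, Fintype.card_fun, Fintype.card_fin, sum_const, smul_eq_mul] at h
  have hq : 0 < Fintype.card F := Fintype.card_pos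
  refine Nat.eq_of_mul_eq_mul_left hq ?_
  change _ * #{y : Fin 3 → F | f y = 1} = _
  rw [← h]; ring

end Counting


/-- If few pairs are bad and few triples are degenerate, some non-degenerate triple has no bad
pair. -/
theorem exists_good_triple {α : Type*} (N : Finset α) (B : α → α → Prop)
    (E : α → α → α → Prop) [DecidableRel B] [∀ x y, DecidablePred (E x y)] (k : ℕ)
    (hE : ∀ x ∈ N, ∀ y ∈ N, x ≠ y → #{z ∈ N | E x y z} ≤ k)
    (hN : 3 * (∑ x ∈ N, #{y ∈ N | B x y}) + #N * (k + 1) < #N ^ 2) :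
    ∃ x ∈ N, ∃ y ∈ N, ∃ z ∈ N, ¬ B x y ∧ ¬ B x z ∧ ¬ B y z ∧ ¬ E x y z := by
  classical
  by_contra! hcon
  have hpos : 0 < #N := by
    by_contra! h0
    simp [Nat.le_zero.1 h0] at hN
  -- The `+ 1` pays for the diagonal `x = y`, where `hE` says nothing.
  have hE' : ∀ x ∈ N, ∑ y ∈ N, #{z ∈ N | E x y z} ≤ #N * (k + 1) := by
    intro x hx
    calc ∑ y ∈ N, #{z ∈ N | E x y z} ≤ ∑ y ∈ N, (k + if x = y then #N else 0) := by
          refine sum_le_sum fun y hy => ?_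
          split_ifs with h
          · exact (card_filter_le _ _).trans (Nat.le_add_left _ _)
          · exact hE x hx y hy h
      _ = #N * (k + 1) := by
          rw [sum_add_distrib, sum_ite_eq, if_pos hx, sum_const, smul_eq_mul]; ring
  have key : ∑ _x ∈ N, ∑ _y ∈ N, ∑ _z ∈ N, 1 ≤ ∑ x ∈ N, ∑ y ∈ N, ∑ z ∈ N,
      ((if B x y then 1 else 0) + (if B x z then 1 else 0) + (if B y z then 1 else 0) +
        (if E x y z then 1 else 0)) := by
    refine sum_le_sum fun x hx => sum_le_sum fun y hy => sum_le_sum fun z hz => ?_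
    have := hcon x hx y hy z hz
    split_ifs <;> first | omega | tauto
  have h1 : ∑ x ∈ N, ∑ y ∈ N, ∑ _z ∈ N, (if B x y then 1 else 0) =
      #N * ∑ x ∈ N, #{y ∈ N | B x y} := by
    simp only [sum_const, smul_eq_mul, ← mul_sum, card_filter]
  have h2 : ∑ x ∈ N, ∑ _y ∈ N, ∑ z ∈ N, (if B x z then 1 else 0) =
      #N * ∑ x ∈ N, #{y ∈ N | B x y} := by
    simp only [sum_const, smul_eq_mul, ← mul_sum, card_filter]
  have h3 : ∑ _x ∈ N, ∑ y ∈ N, ∑ z ∈ N, (if B y z then 1 else 0) =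
      #N * ∑ x ∈ N, #{y ∈ N | B x y} := by
    simp only [sum_const, smul_eq_mul, card_filter]
  have h4 : ∑ x ∈ N, ∑ y ∈ N, ∑ z ∈ N, (if E x y z then 1 else 0) ≤ #N * (#N * (k + 1)) := by
    simp only [← card_filter]
    calc _ ≤ ∑ _x ∈ N, #N * (k + 1) := sum_le_sum hE'
      _ = _ := by rw [sum_const, smul_eq_mul]
  simp only [sum_add_distrib] at key
  rw [h1, h2, h3] at key
  simp only [sum_const, smul_eq_mul, mul_one] at key
  have := Nat.mul_lt_mul_of_pos_left hN hpos
  nlinarith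

/-! ### Second moment of the degrees -/

section Moments

variable {F : Type*} [Field F] [Fintype F] [DecidableEq F]

theorem sum_card_adj {A : Finset (Fin 3 → F)} (hA : 0 ∉ A) :
    ∑ y : Fin 3 → F, #{x ∈ A | x ⬝ᵥ y = 1} = Fintype.card F ^ 2 * #A := by
  simp only [card_filter]
  rw [sum_comm]
  simp only [← card_filter]
  rw [sum_congr rfl fun x hx => card_neighbours (ne_of_mem_of_not_mem hx hA), sum_const,
    smul_eq_mul, mul_comm]

/-- Counts ordered pairs from `A` by common neighbours: `q ^ 2` on the diagonal, at most `q` off it.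
-/
theorem sum_card_adj_sq_le {A : Finset (Fin 3 → F)} (hA : 0 ∉ A) :
    ∑ y : Fin 3 → F, #{x ∈ A | x ⬝ᵥ y = 1} ^ 2 ≤
      Fintype.card F ^ 2 * #A + Fintype.card F * #A ^ 2 := by
  have h : ∀ y : Fin 3 → F, #{x ∈ A | x ⬝ᵥ y = 1} ^ 2 =
      ∑ x ∈ A, ∑ x' ∈ A, if x ⬝ᵥ y = 1 ∧ x' ⬝ᵥ y = 1 then 1 else 0 := by
    intro y
    rw [card_filter, sq, sum_mul_sum]
    refine sum_congr rfl fun x _ => sum_congr rfl fun x' _ => ?_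
    split_ifs <;> simp_all
  simp only [h]
  rw [sum_comm]
  calc _ ≤ ∑ x ∈ A, (Fintype.card F ^ 2 + Fintype.card F * #A) := by
        refine sum_le_sum fun x hx => ?_
        rw [sum_comm]
        simp only [← card_filter]
        calc _ ≤ ∑ x' ∈ A, (Fintype.card F + if x = x' then Fintype.card F ^ 2 else 0) := by
              refine sum_le_sum fun x' hx' => ?_
              split_ifs with hxx
              · subst hxx
                simp only [and_self]
                rw [card_neighbours (ne_of_mem_of_not_mem hx hA)]
                exact Nat.le_add_left _ _
              · exact card_common_le hxx _
          _ = _ := by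
              rw [sum_add_distrib, sum_ite_eq, if_pos hx, sum_const, smul_eq_mul]; ring
    _ = _ := by rw [sum_const, smul_eq_mul]; ring

/-- Few vectors have less than half of the expected number of neighbours in `A`. -/
theorem card_low_degree_mul_le {A : Finset (Fin 3 → F)} (hA : 0 ∉ A) :
    #{y : Fin 3 → F | 2 * Fintype.card F * #{x ∈ A | x ⬝ᵥ y = 1} ≤ #A} * #A ≤
      4 * Fintype.card F ^ 4 := by
  rcases Nat.eq_zero_or_pos #A with h0 | hpos
  · simp [h0]
  set q := Fintype.card F
  set d : (Fin 3 → F) → ℕ := fun y => #{x ∈ A | x ⬝ᵥ y = 1} with hd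
  have h1 : ∑ y, (d y : ℤ) = q ^ 2 * #A := by exact_mod_cast sum_card_adj hA
  have h2 : ∑ y, (d y : ℤ) ^ 2 ≤ q ^ 2 * #A + q * #A ^ 2 := by
    exact_mod_cast sum_card_adj_sq_le hA
  -- Variance about the mean `#A / q`, scaled by `q ^ 2`; the terms in `#A ^ 2` cancel.
  have h3 : ∑ y, ((#A : ℤ) - q * d y) ^ 2 ≤ q ^ 4 * #A := by
    have : ∀ y, ((#A : ℤ) - q * d y) ^ 2 = #A ^ 2 - 2 * q * #A * d y + q ^ 2 * d y ^ 2 := by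
      intro y; ring
    simp only [this, sum_add_distrib, sum_sub_distrib, ← mul_sum, h1, sum_const, card_univ,
      Fintype.card_fun, Fintype.card_fin, nsmul_eq_mul, Nat.cast_pow]
    have := mul_le_mul_of_nonneg_left h2 (sq_nonneg (q : ℤ))
    linarith
  have h4 : ∑ y with 2 * q * d y ≤ #A, (#A : ℤ) ^ 2 ≤ ∑ y, 4 * ((#A : ℤ) - q * d y) ^ 2 := by
    refine (sum_le_sum fun y hy => ?_).trans
      (sum_le_sum_of_subset_of_nonneg (filter_subset _ _) fun _ _ _ => by positivity)
    have hy : 2 * (q : ℤ) * d y ≤ #A := by exact_mod_cast (mem_filter.1 hy).2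
    have h0 : (0 : ℤ) ≤ #A := by positivity
    have : (0 : ℤ) ≤ #A - 2 * (q * d y) := by linarith
    have h5 : (0 : ℤ) ≤ 3 * #A - 2 * (q * d y) := by linarith
    nlinarith [mul_nonneg this h5]
  rw [sum_const, nsmul_eq_mul, ← mul_sum] at h4
  have h6 : #{y | 2 * q * d y ≤ #A} * #A * #A ≤ 4 * q ^ 4 * #A := by
    have : ((#{y | 2 * q * d y ≤ #A} : ℕ) : ℤ) * #A * #A ≤ 4 * q ^ 4 * #A := by linarith
    exact_mod_cast this
  exact Nat.le_of_mul_le_mul_right h6 hpos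

end Moments


/-! ### Constructing a shattered triple -/

section Shattering

variable {F : Type*} [Field F]

theorem injective_vec_three {α : Type*} {a b c : α} (hab : a ≠ b) (hac : a ≠ c) (hbc : b ≠ c) :
    Function.Injective ![a, b, c] := by
  intro i j hij
  fin_cases i <;> fin_cases j <;>
    first
    | rfl
    | exact absurd hij hab
    | exact absurd hij hac
    | exact absurd hij hbc
    | exact absurd hij.symm hab
    | exact absurd hij.symm hac
    | exact absurd hij.symm hbc

/-- Three linearly independent vectors have at most one common neighbour. -/
theorem eq_of_det_ne_zero {x : Fin 3 → Fin 3 → F} (hx : x 2 ⬝ᵥ crossProduct (x 0) (x 1) ≠ 0)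
    {v w : Fin 3 → F} (hv : ∀ i, x i ⬝ᵥ v = 1) (hw : ∀ i, x i ⬝ᵥ w = 1) : v = w := by
  rw [triple_product_eq_det] at hx
  refine sub_eq_zero.1 (Matrix.eq_zero_of_mulVec_eq_zero hx ?_)
  ext i
  fin_cases i <;> simp [Matrix.mulVec, hv, hw]

variable [Fintype F] [DecidableEq F]

theorem exists_forall_adj_iff_mem {W : Finset (Fin 3 → F)}
    (hW : 3 * Fintype.card F ^ 2 < #W) {x : Fin 3 → Fin 3 → F} (hx0 : ∀ i, x i ≠ 0)
    (hinj : Function.Injective x)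
    (hdeg : ∀ i, 2 * Fintype.card F < #{v ∈ W | x i ⬝ᵥ v = 1}) {y : Fin 3 → F} (hy : y ∈ W)
    (hxy : ∀ i, x i ⬝ᵥ y = 1) (huniq : ∀ v, (∀ i, x i ⬝ᵥ v = 1) → v = y)
    (hpair : ∀ i j, i ≠ j → ∃ v ∈ W, v ≠ y ∧ x i ⬝ᵥ v = 1 ∧ x j ⬝ᵥ v = 1) (S : Finset (Fin 3)) :
    ∃ v ∈ W, ∀ i, x i ⬝ᵥ v = 1 ↔ i ∈ S := by
  have hS : #S ≤ 3 := by simpa using card_le_univ S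
  obtain h | h | h | h : #S = 0 ∨ #S = 1 ∨ #S = 2 ∨ #S = 3 := by omega
  · have hlt : #((univ : Finset (Fin 3)).biUnion fun i => {v ∈ W | x i ⬝ᵥ v = 1}) < #W := by
      refine lt_of_le_of_lt (card_biUnion_le_card_mul _ _ (Fintype.card F ^ 2) fun i _ => ?_)
        (by simpa using hW)
      rw [← card_neighbours (hx0 i)]
      exact card_le_card (filter_subset_filter _ (subset_univ _))
    obtain ⟨v, hv, hv'⟩ := exists_mem_notMem_of_card_lt_card hlt
    refine ⟨v, hv, fun i => ?_⟩
    rw [card_eq_zero] at h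
    subst h
    simp only [mem_biUnion, mem_univ, mem_filter, true_and, not_exists, not_and] at hv'
    simpa using hv' i hv
  · obtain ⟨j, rfl⟩ := card_eq_one.1 h
    have hlt : #((univ.erase j).biUnion fun i => {v ∈ W | x i ⬝ᵥ v = 1 ∧ x j ⬝ᵥ v = 1}) <
        #{v ∈ W | x j ⬝ᵥ v = 1} := by
      refine lt_of_le_of_lt (card_biUnion_le_card_mul _ _ (Fintype.card F) fun i hi => ?_)
        (by simpa using hdeg j)
      exact card_common_le (hinj.ne (ne_of_mem_erase hi)) W
    obtain ⟨v, hv, hv'⟩ := exists_mem_notMem_of_card_lt_card hlt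
    obtain ⟨hvW, hv⟩ := mem_filter.1 hv
    refine ⟨v, hvW, fun i => ?_⟩
    simp only [mem_biUnion, mem_erase, mem_univ, mem_filter, not_exists, not_and] at hv'
    rw [mem_singleton]
    refine ⟨fun hi => ?_, fun hi => hi ▸ hv⟩
    by_contra hij
    exact hv' i ⟨hij, trivial⟩ hvW hi hv
  · obtain ⟨j, k, hjk, rfl⟩ := card_eq_two.1 h
    obtain ⟨v, hvW, hne, hj, hk⟩ := hpair j k hjk
    refine ⟨v, hvW, fun i => ?_⟩
    rw [mem_insert, mem_singleton]
    refine ⟨fun hi => ?_, ?_⟩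
    · by_contra! hijk
      -- Adjacency to the third vector as well would make `v` equal to `y`.
      refine hne (huniq v fun l => ?_)
      obtain rfl | rfl | rfl : l = i ∨ l = j ∨ l = k := by omega
      exacts [hi, hj, hk]
    · rintro (rfl | rfl)
      exacts [hj, hk]
  · have : S = univ := by
      rw [← card_eq_iff_eq_univ]; simpa using h
    exact ⟨y, hy, by simpa [this] using hxy⟩

/-- A set of at least `200 q ^ 2` vectors contains three vectors that are shattered by the
neighbourhoods of its members. -/
theorem exists_shattered_triple {W : Finset (Fin 3 → F)} (h0 : 0 ∉ W)
    (hW : 200 * Fintype.card F ^ 2 ≤ #W) :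
    ∃ x : Fin 3 → Fin 3 → F, (∀ i, x i ∈ W) ∧
      ∀ S : Finset (Fin 3), ∃ v ∈ W, ∀ i, x i ⬝ᵥ v = 1 ↔ i ∈ S := by
  have hq : 1 ≤ Fintype.card F := Fintype.card_pos
  have hlow := card_low_degree_mul_le h0
  set q := Fintype.card F with hqdef
  set H : Finset (Fin 3 → F) := {u ∈ W | #W < 2 * q * #{x ∈ W | x ⬝ᵥ u = 1}} with hH
  have hHW : H ⊆ W := filter_subset _ _
  have hHcard : #W ≤ 2 * #H := by
    have h1 : #H + #{u ∈ W | ¬ #W < 2 * q * #{x ∈ W | x ⬝ᵥ u = 1}} = #W :=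
      card_filter_add_card_filter_not _
    have h2 : #{u ∈ W | ¬ #W < 2 * q * #{x ∈ W | x ⬝ᵥ u = 1}} ≤
        #{u | 2 * q * #{x ∈ W | x ⬝ᵥ u = 1} ≤ #W} := by
      simp only [not_lt]
      exact card_le_card (filter_subset_filter _ (subset_univ _))
    by_contra! hlt
    have h3 : #W * #W ≤ 8 * q ^ 4 := by
      have := (Nat.mul_le_mul_right #W h2).trans hlow
      nlinarith
    have h4 := Nat.mul_le_mul hW hW
    have : 0 < q ^ 4 := by positivity
    nlinarith
  have hlow' := card_low_degree_mul_le (fun h => h0 (hHW h) : (0 : Fin 3 → F) ∉ H)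
  rw [← hqdef] at hlow'
  -- Degrees are now counted into `H`, so that the triple chosen near `y` consists of high-degree
  -- vectors.
  set G : Finset (Fin 3 → F) := {u ∈ W | #H < 2 * q * #{x ∈ H | x ⬝ᵥ u = 1}} with hG
  have hGW : G ⊆ W := filter_subset _ _
  have hGcard : #W ≤ 2 * #G := by
    have h1 : #G + #{u ∈ W | ¬ #H < 2 * q * #{x ∈ H | x ⬝ᵥ u = 1}} = #W :=
      card_filter_add_card_filter_not _
    have h2 : #{u ∈ W | ¬ #H < 2 * q * #{x ∈ H | x ⬝ᵥ u = 1}} ≤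
        #{u | 2 * q * #{x ∈ H | x ⬝ᵥ u = 1} ≤ #H} := by
      simp only [not_lt]
      exact card_le_card (filter_subset_filter _ (subset_univ _))
    by_contra! hlt
    have h3 : #W * #W ≤ 16 * q ^ 4 := by
      have h5 := (Nat.mul_le_mul_right #H h2).trans hlow'
      have h6 := Nat.mul_le_mul (show #W ≤ 2 * #{u ∈ W | ¬ #H < 2 * q * #{x ∈ H | x ⬝ᵥ u = 1}}
        by omega) hHcard
      linarith
    have h4 := Nat.mul_le_mul hW hW
    have : 0 < q ^ 4 := by positivity
    nlinarith
  set B : (Fin 3 → F) → (Fin 3 → F) → (Fin 3 → F) → Prop :=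
    fun y x x' => ∀ y' ∈ W, x ⬝ᵥ y' = 1 → x' ⬝ᵥ y' = 1 → y' = y with hB
  have hdec : ∀ y, DecidableRel (B y) := fun y x x' => Classical.dec _
  set N : (Fin 3 → F) → Finset (Fin 3 → F) := fun y => {x ∈ H | x ⬝ᵥ y = 1} with hNdef
  have hBsum : ∑ y ∈ G, ∑ x ∈ N y, #{x' ∈ N y | B y x x'} ≤ #W * #W := by
    calc ∑ y ∈ G, ∑ x ∈ N y, #{x' ∈ N y | B y x x'}
        ≤ ∑ y ∈ W, ∑ x ∈ W, ∑ x' ∈ W,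
          if x ⬝ᵥ y = 1 ∧ x' ⬝ᵥ y = 1 ∧ B y x x' then 1 else 0 := by
          refine (sum_le_sum fun y _ => ?_).trans (sum_le_sum_of_subset hGW)
          rw [hNdef, sum_filter]
          refine (sum_le_sum fun x _ => ?_).trans (sum_le_sum_of_subset hHW)
          split_ifs with hx
          · rw [filter_filter, card_filter]
            simp only [hx, true_and]
            exact sum_le_sum_of_subset hHW
          · exact Nat.zero_le _
      _ = ∑ x ∈ W, ∑ x' ∈ W, #{y ∈ W | x ⬝ᵥ y = 1 ∧ x' ⬝ᵥ y = 1 ∧ B y x x'} := by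
          rw [sum_comm]
          refine sum_congr rfl fun x _ => ?_
          rw [sum_comm]
          simp only [card_filter]
      _ ≤ ∑ _x ∈ W, ∑ _x' ∈ W, 1 := by
          refine sum_le_sum fun x _ => sum_le_sum fun x' _ => card_le_one.2 ?_
          intro a ha b hb
          obtain ⟨haW, hxa, hxa', -⟩ := mem_filter.1 ha
          obtain ⟨-, -, -, hb⟩ := mem_filter.1 hb
          exact hb a haW hxa hxa'
      _ = _ := by simp
  have hsize : ∀ y ∈ G, #W < 4 * q * #(N y) := by
    intro y hy
    have := (mem_filter.1 hy).2
    change #H < 2 * q * #(N y) at this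
    linarith
  obtain ⟨y, hyG, hy⟩ : ∃ y ∈ G,
      3 * (∑ x ∈ N y, #{x' ∈ N y | B y x x'}) + #(N y) * (q + 1) < #(N y) ^ 2 := by
    by_contra! hcon
    -- Summed over `G`, this gives `#G ≤ 64 q ^ 2`, against `#G ≥ #W / 2 ≥ 100 q ^ 2`.
    have h1 : ∀ y ∈ G, #W * #W ≤ 64 * q ^ 2 * ∑ x ∈ N y, #{x' ∈ N y | B y x x'} := by
      intro y hy
      have h2 := hcon y hy
      have h3 := hsize y hy
      set n := #(N y)
      set b := ∑ x ∈ N y, #{x' ∈ N y | B y x x'}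
      have h4 : 50 * q ≤ n := by
        by_contra! h
        nlinarith
      -- Here `q + 1 ≤ 2 q ≤ n / 25`, so the degenerate term is absorbed.
      have h5 : n ^ 2 ≤ 4 * b := by nlinarith
      calc #W * #W ≤ (4 * q * n) * (4 * q * n) := Nat.mul_le_mul h3.le h3.le
        _ = 16 * q ^ 2 * n ^ 2 := by ring
        _ ≤ 16 * q ^ 2 * (4 * b) := Nat.mul_le_mul_left _ h5
        _ = _ := by ring
    have h2 := sum_le_sum h1
    rw [sum_const, smul_eq_mul, ← mul_sum] at h2
    have h3 := h2.trans (Nat.mul_le_mul_left _ hBsum)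
    have hq2 : 0 < q ^ 2 := by positivity
    have hWpos : 0 < #W * #W := by
      have : 0 < #W := by omega
      positivity
    have := Nat.le_of_mul_le_mul_right h3 hWpos
    omega
  have hyW := hGW hyG
  have hE : ∀ x ∈ N y, ∀ x' ∈ N y, x ≠ x' →
      #{z ∈ N y | z ⬝ᵥ crossProduct x x' = 0} ≤ q := by
    intro x hx x' hx' hne
    have hc := crossProduct_ne_zero hne (mem_filter.1 hx).2 (mem_filter.1 hx').2
    -- Such `z` are common neighbours of the distinct vectors `y` and `y + x ⨯₃ x'`.
    refine (card_le_card ?_).trans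
      (card_common_le (show y + crossProduct x x' ≠ y by simpa using hc) univ)
    intro z hz
    simp only [hNdef, mem_filter] at hz
    simp only [mem_filter, mem_univ, true_and, add_dotProduct]
    rw [dotProduct_comm y z, dotProduct_comm _ z, hz.1.2, hz.2]
    simp
  obtain ⟨a, ha, b, hb, c, hc, hab, hac, hbc, habc⟩ :=
    exists_good_triple (N y) (B y) (fun x x' z => z ⬝ᵥ crossProduct x x' = 0) q hE hy
  have hmem : ∀ i, ![a, b, c] i ∈ N y := by
    intro i; fin_cases i <;> assumption
  have hB' : ∀ i j, i < j → ¬ B y (![a, b, c] i) (![a, b, c] j) := by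
    intro i j hij
    fin_cases i <;> fin_cases j <;> first | assumption | exact absurd hij (by decide)
  have hmemW : ∀ i, ![a, b, c] i ∈ W := fun i => hHW (mem_filter.1 (hmem i)).1
  have hx0 : ∀ i, ![a, b, c] i ≠ 0 := fun i => ne_of_mem_of_not_mem (hmemW i) h0
  have hadj : ∀ i, ![a, b, c] i ⬝ᵥ y = 1 := fun i => (mem_filter.1 (hmem i)).2
  have hpair : ∀ i j, i ≠ j → ∃ v ∈ W, v ≠ y ∧ ![a, b, c] i ⬝ᵥ v = 1 ∧ ![a, b, c] j ⬝ᵥ v = 1 := by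
    intro i j hij
    rcases lt_or_gt_of_ne hij with h | h
    · have := hB' i j h
      simp only [hB, not_forall] at this
      obtain ⟨v, hv, hi, hj, hne⟩ := this
      exact ⟨v, hv, hne, hi, hj⟩
    · have := hB' j i h
      simp only [hB, not_forall] at this
      obtain ⟨v, hv, hj, hi, hne⟩ := this
      exact ⟨v, hv, hne, hi, hj⟩
  have hinj : Function.Injective ![a, b, c] := by
    have h1 : a ≠ b := by
      rintro rfl
      exact habc (by simp)
    have h2 : a ≠ c := by
      rintro rfl
      exact habc (dot_self_cross _ _)
    have h3 : b ≠ c := by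
      rintro rfl
      exact habc (dot_cross_self _ _)
    exact injective_vec_three h1 h2 h3
  refine ⟨![a, b, c], hmemW, exists_forall_adj_iff_mem (by nlinarith) hx0 hinj ?_ hyW hadj
    (fun v hv => eq_of_det_ne_zero habc hv hadj) hpair⟩
  intro i
  have h1 := (mem_filter.1 (mem_filter.1 (hmem i)).1).2
  simp only [dotProduct_comm _ (![a, b, c] i)] at h1
  by_contra! h2
  rw [← hqdef] at h2
  nlinarith

end Shattering

/-! ### The upper bound -/

section Relation

variable {F : Type*} [Field F]

/-- No four vectors of `F ^ 3` are shattered by neighbourhoods. -/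
theorem not_shattered_four (x : Fin 4 → Fin 3 → F) :
    ¬ ∀ S : Finset (Fin 4), ∃ v : Fin 3 → F, ∀ i, x i ⬝ᵥ v = 1 ↔ i ∈ S := by
  intro h
  have hdep : ¬ LinearIndependent F x := fun hl => by
    simpa using hl.fintype_card_le_finrank
  obtain ⟨c, hc, i, hi⟩ := Fintype.not_linearIndependent_iff.1 hdep
  have hsum : ∀ v : Fin 3 → F, ∑ j, c j * (x j ⬝ᵥ v) = 0 := by
    intro v
    have := congrArg (· ⬝ᵥ v) hc
    simpa [sum_dotProduct, smul_dotProduct] using this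
  obtain ⟨v, hv⟩ := h univ
  obtain ⟨w, hw⟩ := h (univ.erase i)
  have hwi : x i ⬝ᵥ w ≠ 1 := fun h => by simpa using (hw i).1 h
  have h1 := hsum v
  have h2 := hsum w
  rw [← add_sum_erase _ _ (mem_univ i)] at h1 h2
  rw [(hv i).2 (mem_univ i), sum_congr rfl fun j _ => by rw [(hv j).2 (mem_univ j)]] at h1
  rw [sum_congr rfl fun j hj => by rw [(hw j).2 hj]] at h2
  -- `v` and `w` agree on every vector but `x i`, so subtracting leaves one term.
  have h3 : c i * (x i ⬝ᵥ w - 1) = 0 := by linear_combination h2 - h1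
  rcases mul_eq_zero.1 h3 with h4 | h4
  exacts [hi h4, hwi (sub_eq_zero.1 h4)]

end Relation

end DotProduct


/-! ### From shattered tuples to `vcDim` -/

open Classical in
theorem shatters_image_iff {X : Type*} [Fintype X] (H : Finset (X → Bool)) (s : Finset X) :
    (H.image fun h => Finset.univ.filter fun x => h x = true).Shatters s ↔
      ∀ t ⊆ s, ∃ h ∈ H, ∀ x ∈ s, h x = true ↔ x ∈ t := by
  simp only [Finset.Shatters, Finset.mem_image, exists_exists_and_eq_and]
  refine forall₂_congr fun t ht => exists_congr fun h => and_congr_right fun _ => ?_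
  rw [Finset.ext_iff]
  refine forall_congr' fun x => ?_
  rw [Finset.mem_inter, Finset.mem_filter]
  have := @ht x
  have := Finset.mem_univ x
  tauto

theorem card_le_vcDim {X : Type*} [Fintype X] {H : Finset (X → Bool)} {s : Finset X}
    (hs : ∀ t ⊆ s, ∃ h ∈ H, ∀ x ∈ s, h x = true ↔ x ∈ t) : s.card ≤ vcDim H := by
  classical
  exact ((shatters_image_iff H s).2 hs).card_le_vcDim

theorem exists_card_eq_vcDim {X : Type*} [Fintype X] {H : Finset (X → Bool)} {n : ℕ}
    (hn : n ≤ vcDim H) (hn0 : 0 < n) :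
    ∃ s : Finset X, s.card = n ∧ ∀ t ⊆ s, ∃ h ∈ H, ∀ x ∈ s, h x = true ↔ x ∈ t := by
  classical
  obtain ⟨s, hs, hle⟩ := (Finset.le_sup_iff (by simpa using hn0)).1 hn
  obtain ⟨s', hs', hcard⟩ := Finset.exists_subset_card_eq hle
  exact ⟨s', hcard, (shatters_image_iff H s').1 ((Finset.mem_shatterer.1 hs).mono_right hs')⟩

theorem vcDim_adjFamily_le {V : Type*} (adj : V → V → Prop) (U : Finset V) (n : ℕ)
    (h : ∀ x : Fin (n + 1) → V, ¬ ∀ S : Finset (Fin (n + 1)), ∃ v, ∀ i, adj (x i) v ↔ i ∈ S) :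
    vcDim (adjFamily adj U) ≤ n := by
  classical
  by_contra! hlt
  obtain ⟨s, hcard, hs⟩ := exists_card_eq_vcDim (Nat.succ_le_of_lt hlt) n.succ_pos
  let e := (Finset.equivFinOfCardEq hcard).symm
  refine h (fun i => (e i).1.1) fun S => ?_
  obtain ⟨f, hf, hfS⟩ := hs (S.image fun i => (e i).1) (by
    intro u hu
    obtain ⟨i, -, rfl⟩ := Finset.mem_image.1 hu
    exact (e i).2)
  obtain ⟨v, -, rfl⟩ := Finset.mem_image.1 hf
  refine ⟨v, fun i => ?_⟩
  have := hfS _ (e i).2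
  simpa [adjFun] using this

theorem le_vcDim_adjFamily {V : Type*} (adj : V → V → Prop) (U : Finset V) (n : ℕ)
    (x : Fin n → V) (hx : ∀ i, x i ∈ U)
    (h : ∀ S : Finset (Fin n), ∃ v ∈ U, ∀ i, adj (x i) v ↔ i ∈ S) :
    n ≤ vcDim (adjFamily adj U) := by
  classical
  -- Realising the singletons `{i}` already separates the points.
  have hinj : Function.Injective fun i => (⟨x i, hx i⟩ : U) := by
    intro i j hij
    have hij : x i = x j := congrArg Subtype.val hij
    obtain ⟨v, -, hv⟩ := h {i}
    have := (hv j).1 (hij ▸ (hv i).2 (Finset.mem_singleton_self i))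
    exact (Finset.mem_singleton.1 this).symm
  have hle : (Finset.univ.image fun i => (⟨x i, hx i⟩ : U)).card ≤ vcDim (adjFamily adj U) := by
    refine card_le_vcDim fun t _ => ?_
    obtain ⟨v, hvU, hv⟩ := h {i | (⟨x i, hx i⟩ : U) ∈ t}
    refine ⟨adjFun adj U v, Finset.mem_image_of_mem _ hvU, fun u hu => ?_⟩
    obtain ⟨i, -, rfl⟩ := Finset.mem_image.1 hu
    simpa [adjFun] using hv i
  rwa [Finset.card_image_of_injective _ hinj, Finset.card_univ, Fintype.card_fin] at hle

/-- The neighbourhoods in a set of at least `200 q ^ 2` vertices have VC-dimension `3`. -/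
theorem vcDim_eq_three {F : Type*} [Field F] [Fintype F] (U : Finset (Vertex F 3))
    (hU : 200 * Fintype.card F ^ 2 ≤ U.card) : vcDim (adjFamily Adj U) = 3 := by
  classical
  refine le_antisymm (vcDim_adjFamily_le _ _ _ fun x hx => ?_) ?_
  · refine not_shattered_four (fun i => (x i).1) fun S => ?_
    obtain ⟨v, hv⟩ := hx S
    exact ⟨v.1, hv⟩
  · obtain ⟨x, hxU, hx⟩ := exists_shattered_triple (W := U.map (Function.Embedding.subtype _))
      (by simp) (by simpa using hU)
    simp only [Finset.mem_map, Function.Embedding.subtype_apply] at hxU hx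
    choose x' hx'U hx' using hxU
    refine le_vcDim_adjFamily _ _ _ x' hx'U fun S => ?_
    obtain ⟨_, ⟨v, hvU, rfl⟩, hv⟩ := hx S
    refine ⟨v, hvU, fun i => ?_⟩
    rw [← hv i, ← hx' i]
    rfl

end DotProductVC

theorem mainTheorem3 :
    ∃ C : ℝ, 0 < C ∧
      ∀ (F : Type*) [Field F] [Fintype F] (U : Finset (DotProductVC.Vertex F 3)),
        (C * (Fintype.card F : ℝ) ^ (2 : ℕ) ≤ (U.card : ℝ) →
          2 ≤ DotProductVC.vcDim (DotProductVC.adjFamily DotProductVC.Adj U)) ∧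
        (C * (Fintype.card F : ℝ) ^ (5 / 2 : ℝ) ≤ (U.card : ℝ) →
          DotProductVC.vcDim (DotProductVC.adjFamily DotProductVC.Adj U) = 3) := by
  refine ⟨200, by norm_num, fun F _ _ U => ?_⟩
  have key : 200 * (Fintype.card F : ℝ) ^ (2 : ℕ) ≤ (U.card : ℝ) →
      DotProductVC.vcDim (DotProductVC.adjFamily DotProductVC.Adj U) = 3 := fun h =>
    DotProductVC.vcDim_eq_three U (by exact_mod_cast h)
  refine ⟨fun h => by rw [key h]; norm_num, fun h => key (le_trans ?_ h)⟩
  have hq : (1 : ℝ) ≤ Fintype.card F := by exact_mod_cast Fintype.card_pos (α := F)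
  have := Real.rpow_le_rpow_of_exponent_le hq (show ((2 : ℕ) : ℝ) ≤ 5 / 2 by norm_num)
  rw [Real.rpow_natCast] at this
  linarith
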